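/- Let $(S,\mathfrak m)$ be a regular local ring of dimension $n$, let $I\subset S$ be an ideal, and suppose that $R=S/I$ has dimension $d$ (in particular $R\neq 0$). Let $$0\to F_k\xrightarrow{\alpha_k}F_{k-1}\xrightarrow{\alpha_{k-1}}\cdots\to F_0\to R\to 0$$ be a minimal free $S$-resolution of $R$ of length $k$, that is, an exact sequence of $S$-modules in which every $F_i$ is finitely generated and free, $\alpha_i(F_i)\subseteq\mathfrak m F_{i-1}$ for all $i\ge 1$, and $F_k\neq 0$. Call $R$ Gorenstein if $R$ is Cohen–Macaulay, i.e. $\operatorname{depth}R=\dim R$, and the $R$-module $\operatorname{Ext}_S^{n-d}(R,S)$ is free of rank $1$. Then $R$ is Gorenstein if and only if $k=n-d$ and $F_k\cong S$ as $S$-modules. -/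

import Mathlib

open CategoryTheory CategoryTheory.Abelian

universe u

/-- The depth of a local ring `R`: the supremum of the lengths of the `R`-regular sequences
contained in the maximal ideal. -/
noncomputable def localDepth (R : Type u) [CommRing R] [IsLocalRing R] : ℕ∞ :=
  ⨆ rs : {rs : List R // RingTheory.Sequence.IsRegular R rs ∧
    ∀ r ∈ rs, r ∈ IsLocalRing.maximalIdeal R}, (rs.1.length : ℕ∞)

/-- A Noetherian local ring is Cohen-Macaulay if its depth equals its Krull dimension. -/
class IsCohenMacaulayLocalRing (R : Type u) [CommRing R] : Prop extends
    IsLocalRing R, IsNoetherianRing R where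
  depth_eq_dim : ((localDepth R : ℕ∞) : WithBot ℕ∞) = ringKrullDim R

section ExtOver

variable (S R : Type u) [CommRing S] [CommRing R] [Algebra S R]

/-- `Ext_S^c(R, S)` for an `S`-algebra `R`; it is given its natural `R`-module structure below. -/
def ExtOver (c : ℕ) : Type u :=
  Ext (ModuleCat.of S R) (ModuleCat.of S S) c

noncomputable instance (c : ℕ) : AddCommGroup (ExtOver S R c) :=
  inferInstanceAs (AddCommGroup (Ext (ModuleCat.of S R) (ModuleCat.of S S) c))

/-- Multiplication by `r : R`, as an endomorphism of the `S`-module `R`. -/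
def mulEnd (r : R) : ModuleCat.of S R ⟶ ModuleCat.of S R :=
  ModuleCat.ofHom (LinearMap.mulLeft S r)

/-- `R` acts on `Ext_S^c(R, S)` by functoriality in the first argument: `r` acts as the map
induced by multiplication by `r` on `R`. -/
noncomputable instance (c : ℕ) : Module R (ExtOver S R c) where
  smul r x := (Ext.mk₀ (mulEnd S R r)).comp
    (show Ext (ModuleCat.of S R) (ModuleCat.of S S) c from x) (zero_add c)
  one_smul x := by
    have h : mulEnd S R 1 = 𝟙 _ := by ext; simp [mulEnd]
    change (Ext.mk₀ (mulEnd S R 1)).comp _ _ = _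
    rw [h]
    exact Ext.mk₀_id_comp _
  mul_smul r s x := by
    have h : mulEnd S R (r * s) = mulEnd S R r ≫ mulEnd S R s := by
      ext x
      exact (congrArg (· * (x : R)) (mul_comm r s)).trans (mul_assoc s r x)
    change (Ext.mk₀ (mulEnd S R (r * s))).comp _ _ =
      (Ext.mk₀ (mulEnd S R r)).comp ((Ext.mk₀ (mulEnd S R s)).comp _ _) _
    rw [h]
    exact (Ext.mk₀_comp_mk₀_assoc _ _ _).symm
  smul_zero r := Ext.comp_zero _ _ _ _ _
  smul_add r x y := Ext.comp_add _ _ _ _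
  add_smul r s x := by
    have h : mulEnd S R (r + s) = mulEnd S R r + mulEnd S R s := by
      ext x
      exact add_mul r s (x : R)
    change (Ext.mk₀ (mulEnd S R (r + s))).comp _ _ =
      (Ext.mk₀ (mulEnd S R r)).comp _ _ + (Ext.mk₀ (mulEnd S R s)).comp _ _
    rw [h, Ext.mk₀_add]
    exact Ext.add_comp _ _ _ _
  zero_smul x := by
    have h : mulEnd S R 0 = 0 := by ext; simp [mulEnd]
    change (Ext.mk₀ (mulEnd S R 0)).comp _ _ = _
    rw [h, Ext.mk₀_zero]
    exact Ext.zero_comp _ _ _ _ _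

/-- Let `R` be a homomorphic image of the regular local ring `S`, with `n = dim S` and
`d = dim R`. Then `R` is Gorenstein if it is a Cohen-Macaulay local ring and its canonical module
`Ext_S^(n-d)(R, S)` is free of rank one as an `R`-module. -/
def IsGorensteinOver : Prop :=
  IsCohenMacaulayLocalRing R ∧
    ∃ n d : ℕ, ringKrullDim S = n ∧ ringKrullDim R = d ∧
      Module.Free R (ExtOver S R (n - d)) ∧ Module.finrank R (ExtOver S R (n - d)) = 1

end ExtOver

/-- The projective resolution `P` of the module `M` over the local ring `S` is a minimal free
resolution `0 → F_k → ⋯ → F_0 → M → 0` of length exactly `k`: the modules `F_i` are finitely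
generated and free, the image of `F_i → F_j` is contained in `m F_j`, where `m` is the maximal
ideal of `S`, and `k` is the last index with `F_k ≠ 0`. -/
structure IsMinimalFreeResolution {S : Type u} [CommRing S] [IsLocalRing S] {M : ModuleCat.{u} S}
    (P : ProjectiveResolution M) (k : ℕ) : Prop where
  free : ∀ i, Module.Free S (P.complex.X i)
  finite : ∀ i, Module.Finite S (P.complex.X i)
  minimal : ∀ i j, LinearMap.range (P.complex.d i j).hom ≤
    IsLocalRing.maximalIdeal S • (⊤ : Submodule S (P.complex.X j))
  nontrivial_last : Nontrivial (P.complex.X k)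
  subsingleton_of_lt : ∀ i, k < i → Subsingleton (P.complex.X i)

/-! Everything is read off from the modules $\operatorname{Ext}^i_S(R,S)$. For a regular local ring
$S$ with residue field $\kappa$, $\operatorname{Ext}^i(\kappa,S)$ is nonzero only for $i=n$. Prime
filtrations and Nakayama (`subsingleton_ext_of_residueField`) then give vanishing of
$\operatorname{Ext}^i(M,S)$ for $i>n$ and for $i<n-\dim M$. Cutting $M$ by regular elements shows
that regular sequences of length $t\le n$ correspond to vanishing for $i>n-t$.

Minimality makes $F_k^*\to\operatorname{Ext}^k(R,S)$ surjective with kernel in $\mathfrak m F_k^*$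
(`exists_surjective_dual_ext`). So $\operatorname{Ext}^k(R,S)\ne0$, whence $k\ge n-d$ and, when
$k\le n$, $\operatorname{depth}R=n-k$. Thus Cohen–Macaulayness amounts to $k=n-d$, and a generator
of $\operatorname{Ext}^k$ then lifts to one of $F_k^*$, forcing $F_k\cong S$.

Conversely, $F_k\cong S$ makes $\operatorname{Ext}^k(R,S)$ cyclic. It is faithful over $R$ because a
scalar killing it kills $R$, by dimension shifting along the syzygies
(`smul_eq_zero_of_ext_smul_eq_zero`). A faithful cyclic module is free of rank one. -/

/-! ### Regular local rings: quotients, integrality, regular parameters. -/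

namespace IsLocalRing

/-- An element of the maximal ideal outside its square can replace one element of any finite
generating set of the maximal ideal. -/
lemma exists_span_insert_erase_eq_maximalIdeal {S : Type*} [CommRing S] [IsLocalRing S]
    [DecidableEq S] {s : Finset S} (hs : Ideal.span (s : Set S) = maximalIdeal S) {x : S}
    (hx : x ∈ maximalIdeal S) (hx2 : x ∉ maximalIdeal S ^ 2) :
    ∃ g ∈ s, Ideal.span (insert x (s.erase g : Set S)) = maximalIdeal S := by
  have hmem : x ∈ Submodule.span S (s : Set S) := by rwa [← hs] at hx
  obtain ⟨f, -, hf⟩ := Submodule.mem_span_finset.mp hmem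
  have hsm : ∀ a ∈ s, a ∈ maximalIdeal S := fun a ha ↦ hs ▸ Ideal.subset_span ha
  obtain ⟨g, hg, hu⟩ : ∃ g ∈ s, IsUnit (f g) := by
    by_contra! h
    refine hx2 (hf ▸ Submodule.sum_mem _ fun a ha ↦ ?_)
    rw [pow_two]
    exact Ideal.mul_mem_mul (h a ha) (hsm a ha)
  refine ⟨g, hg, le_antisymm (Ideal.span_le.mpr ?_) ?_⟩
  · rintro y (rfl | hy)
    exacts [hx, hsm y (Finset.mem_of_mem_erase hy)]
  · set J := Ideal.span (insert x (s.erase g : Set S)) with hJ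
    have hxJ : x ∈ J := Ideal.subset_span (Set.mem_insert _ _)
    have hJs : ∀ a ∈ s.erase g, a ∈ J := fun a ha ↦ Ideal.subset_span (Set.mem_insert_of_mem _ ha)
    have hgJ : g ∈ J := by
      rw [← Finset.add_sum_erase s _ hg, smul_eq_mul] at hf
      have : f g * g ∈ J := by
        rw [← eq_sub_iff_add_eq] at hf
        rw [hf]
        exact J.sub_mem hxJ (Submodule.sum_mem _ fun a ha ↦ J.mul_mem_left _ (hJs a ha))
      exact (Ideal.unit_mul_mem_iff_mem J hu).mp this
    rw [← hs, Ideal.span_le]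
    intro a ha
    by_cases h : a = g
    · exact h ▸ hgJ
    · exact hJs a (Finset.mem_erase.mpr ⟨h, ha⟩)

end IsLocalRing

namespace IsRegularLocalRing

open IsLocalRing RingTheory.Sequence

/-- Exchanging `x` for one of $\dim S$ generators of $\mathfrak m$ leaves at most $\dim S-1$
generators modulo `x`, while the dimension drops by at most one. Since dimension never exceeds the
number of generators, both bounds are equalities. -/
lemma quotient_span_singleton_of_notMem_sq {S : Type u} [CommRing S] [IsRegularLocalRing S] {x : S}
    (hx : x ∈ maximalIdeal S) (hx2 : x ∉ maximalIdeal S ^ 2) :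
    IsRegularLocalRing (S ⧸ Ideal.span {x}) ∧
      ringKrullDim (S ⧸ Ideal.span {x}) + 1 = ringKrullDim S := by
  classical
  have hntr : Nontrivial (S ⧸ Ideal.span {x}) :=
    Ideal.Quotient.nontrivial_iff.mpr fun h ↦
      hx (Ideal.span_singleton_eq_top.mp h)
  have := IsLocalRing.of_surjective' (Ideal.Quotient.mk (Ideal.span {x}))
    Ideal.Quotient.mk_surjective
  obtain ⟨s, hcard, hs⟩ :=
    Submodule.FG.exists_span_finset_card_eq_spanFinrank (maximalIdeal S).fg_of_isNoetherianRing
  obtain ⟨g, hg, hspan⟩ := exists_span_insert_erase_eq_maximalIdeal hs hx hx2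
  have hm : maximalIdeal (S ⧸ Ideal.span {x}) =
      Ideal.span ((s.erase g).image (Ideal.Quotient.mk (Ideal.span {x})) : Finset _) := by
    rw [← map_maximalIdeal_of_surjective _ Ideal.Quotient.mk_surjective,
      ← hspan, Ideal.map_span, Set.image_insert_eq,
      Ideal.Quotient.eq_zero_iff_mem.mpr (Ideal.mem_span_singleton_self x),
      Ideal.span_insert_zero, Finset.coe_image]
  have hle : (maximalIdeal (S ⧸ Ideal.span {x})).spanFinrank + 1 ≤ s.card := by
    rw [← Finset.card_erase_add_one hg, hm]
    gcongr
    refine (Submodule.spanFinrank_span_le_ncard_of_finite (Finset.finite_toSet _)).trans ?_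
    rw [Set.ncard_coe_finset]
    exact Finset.card_image_le
  have hdim : ringKrullDim S = s.card := hcard ▸ (spanFinrank_maximalIdeal (R := S)).symm
  have h1 : ringKrullDim S ≤ ringKrullDim (S ⧸ Ideal.span {x}) + 1 := by
    simpa using ringKrullDim_le_ringKrullDim_quotient_add_encard {x}
      (by simpa [ringJacobson_eq_maximalIdeal] using hx)
  have h2 := ringKrullDim_le_spanFinrank_maximalIdeal (S ⧸ Ideal.span {x})
  have h3 : ((maximalIdeal (S ⧸ Ideal.span {x})).spanFinrank : WithBot ℕ∞) + 1 ≤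
      ringKrullDim S := by
    rw [hdim]; exact_mod_cast hle
  refine ⟨of_spanFinrank_maximalIdeal_le _ ?_, le_antisymm ((by gcongr : _ ≤ _).trans h3) h1⟩
  exact (ENat.WithBot.add_le_add_one_right_iff).mp (h3.trans h1)

/-- Induction on dimension. Prime avoidance yields $x\in\mathfrak m$ outside $\mathfrak m^2$ and all
minimal primes; $(x)$ is prime by induction, and a minimal prime inside it must vanish by Nakayama.
-/
lemma isDomain (S : Type u) [CommRing S] [IsRegularLocalRing S] : IsDomain S := by
  classical
  obtain ⟨n, hn⟩ : ∃ n : ℕ, ringKrullDim S = n := ⟨_, (spanFinrank_maximalIdeal (R := S)).symm⟩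
  induction n generalizing S with
  | zero =>
    have h0 : (maximalIdeal S).spanFinrank = 0 := by
      have := spanFinrank_maximalIdeal (R := S)
      rw [hn] at this
      exact_mod_cast this
    rw [Submodule.spanFinrank_eq_zero_iff_eq_bot (maximalIdeal S).fg_of_isNoetherianRing] at h0
    exact (isField_iff_maximalIdeal_eq.mpr h0).isDomain
  | succ n ih =>
    have hfin := minimalPrimes.finite_of_isNoetherianRing S
    have hmin : maximalIdeal S ∉ minimalPrimes S := fun h ↦ by
      have h0 : (maximalIdeal S).height = 0 := Ideal.height_eq_zero_iff.mpr h
      have := maximalIdeal_height_eq_ringKrullDim (R := S)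
      rw [hn, h0] at this
      norm_cast at this
    obtain ⟨x, hx, hx'⟩ : ∃ x ∈ maximalIdeal S,
        x ∉ ⋃ p ∈ (↑(insert (maximalIdeal S ^ 2) hfin.toFinset) : Set (Ideal S)), (p : Set S) := by
      by_contra! h
      -- Prime avoidance tolerates two non-prime ideals; $\mathfrak m^2$ fills both slots.
      obtain ⟨p, hp, hle⟩ := (Ideal.subset_union_prime (f := id) (maximalIdeal S ^ 2)
        (maximalIdeal S ^ 2) (fun p hp hne _ ↦ by
          rcases Finset.mem_insert.mp hp with hp | hp
          · exact absurd hp hne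
          · exact ((hfin.mem_toFinset).mp hp).1.1)).mp h
      rcases Finset.mem_insert.mp hp with rfl | hp
      · have hbot : maximalIdeal S = ⊥ :=
          Submodule.eq_bot_of_le_smul_of_le_jacobson_bot (maximalIdeal S) (maximalIdeal S)
            (maximalIdeal S).fg_of_isNoetherianRing (by simpa [pow_two] using hle)
            (maximalIdeal_le_jacobson _)
        have := ringKrullDim_eq_zero_of_isField (isField_iff_maximalIdeal_eq.mpr hbot)
        rw [hn] at this
        norm_cast at this
      · have hpm := (hfin.mem_toFinset).mp hp
        have : p.IsPrime := hpm.1.1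
        exact hmin (le_antisymm hle (le_maximalIdeal this.ne_top) ▸ hpm)
    simp only [Finset.coe_insert, Set.Finite.coe_toFinset, Set.mem_iUnion, not_exists,
      Set.mem_insert_iff, SetLike.mem_coe] at hx'
    obtain ⟨hreg, hdim⟩ := quotient_span_singleton_of_notMem_sq hx (hx' _ (Or.inl rfl))
    have hdom := ih (S ⧸ Ideal.span {x}) (by
      rw [hn] at hdim
      exact ENat.WithBot.add_one_cancel.mp (by exact_mod_cast hdim))
    have hprime : (Ideal.span {x}).IsPrime := (Ideal.Quotient.isDomain_iff_prime _).mp hdom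
    obtain ⟨p, hp, hpx⟩ := Ideal.exists_minimalPrimes_le (bot_le : ⊥ ≤ Ideal.span {x})
    have hpp : p.IsPrime := hp.1.1
    have hxp : x ∉ p := hx' p (Or.inr hp)
    -- An element of $p\subseteq(x)$ is $ax$ with $a\in p$, because $x\notin p$; hence
    -- $p\subseteq\mathfrak m p$.
    have hbot : p = ⊥ := by
      refine Submodule.eq_bot_of_le_smul_of_le_jacobson_bot (maximalIdeal S) p
        p.fg_of_isNoetherianRing (fun y hy ↦ ?_) (maximalIdeal_le_jacobson _)
      obtain ⟨a, rfl⟩ := Ideal.mem_span_singleton'.mp (hpx hy)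
      rw [mul_comm]
      exact Submodule.smul_mem_smul hx ((hpp.mem_or_mem hy).resolve_right hxp)
    rw [hbot] at hpp
    exact IsDomain.of_bot_isPrime S

/-- The maximal ideal of a regular local ring is generated by a regular sequence. -/
lemma exists_isRegular_ofList_eq_maximalIdeal (S : Type u) [CommRing S] [IsRegularLocalRing S]
    (n : ℕ) (hn : ringKrullDim S = n) :
    ∃ rs : List S, rs.length = n ∧ IsRegular S rs ∧ Ideal.ofList rs = maximalIdeal S := by
  suffices h : ∃ rs : List S, rs.length = n ∧ IsWeaklyRegular S rs ∧
      Ideal.ofList rs = maximalIdeal S by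
    obtain ⟨rs, h1, h2, h3⟩ := h
    refine ⟨rs, h1, ⟨h2, ?_⟩, h3⟩
    rw [h3]
    simpa using (Ideal.IsPrime.ne_top' (I := maximalIdeal S)).symm
  induction n generalizing S with
  | zero =>
    have h0 : (maximalIdeal S).spanFinrank = 0 := by
      have := spanFinrank_maximalIdeal (R := S)
      rw [hn] at this
      exact_mod_cast this
    rw [Submodule.spanFinrank_eq_zero_iff_eq_bot (maximalIdeal S).fg_of_isNoetherianRing] at h0
    exact ⟨[], rfl, .nil S S, by simp [h0]⟩
  | succ n ih =>
    have := isDomain S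
    obtain ⟨x, hx, hx2⟩ : ∃ x ∈ maximalIdeal S, x ∉ maximalIdeal S ^ 2 := by
      by_contra! hle
      have hbot : maximalIdeal S = ⊥ :=
        Submodule.eq_bot_of_le_smul_of_le_jacobson_bot (maximalIdeal S) (maximalIdeal S)
          (maximalIdeal S).fg_of_isNoetherianRing (fun x hx ↦ by simpa [pow_two] using hle x hx)
          (maximalIdeal_le_jacobson _)
      have := ringKrullDim_eq_zero_of_isField (isField_iff_maximalIdeal_eq.mpr hbot)
      rw [hn] at this
      norm_cast at this
    obtain ⟨hreg, hdim⟩ := quotient_span_singleton_of_notMem_sq hx hx2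
    obtain ⟨rs', hlen, hwr, hspan⟩ := ih (S ⧸ Ideal.span {x}) (by
      rw [hn] at hdim
      exact ENat.WithBot.add_one_cancel.mp (by exact_mod_cast hdim))
    obtain ⟨rs, rfl⟩ : ∃ rs : List S, rs.map (Ideal.Quotient.mk (Ideal.span {x})) = rs' :=
      (List.map_surjective_iff.mpr Ideal.Quotient.mk_surjective) rs'
    refine ⟨x :: rs, by simpa using hlen, ?_, ?_⟩
    · refine .cons (IsSMulRegular.of_ne_zero fun h ↦ hx2 (h ▸ zero_mem _)) ?_
      have e : QuotSMulTop x S ≃ₗ[S] S ⧸ Ideal.span {x} :=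
        Submodule.quotEquivOfEq _ _ (by rw [← Submodule.ideal_span_singleton_smul]; simp)
      rw [e.isWeaklyRegular_congr]
      exact (isWeaklyRegular_map_algebraMap_iff (S ⧸ Ideal.span {x}) _ rs).mp hwr
    · rw [← Ideal.map_ofList] at hspan
      have := congrArg (Ideal.comap (Ideal.Quotient.mk (Ideal.span {x}))) hspan
      rw [Ideal.comap_map_of_surjective _ Ideal.Quotient.mk_surjective, ← RingHom.ker_eq_comap_bot,
        Ideal.mk_ker, eq_maximalIdeal (Ideal.comap_isMaximal_of_surjective
          (Ideal.Quotient.mk (Ideal.span {x})) Ideal.Quotient.mk_surjective)] at this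
      rw [Ideal.ofList_cons, sup_comm, this]

end IsRegularLocalRing

/-! ### Propagating vanishing of Ext from the residue field. -/

section ExtVanishing

open IsLocalRing RingTheory.Sequence Module

variable {S : Type u} [CommRing S]

lemma subsingleton_ext_X₂_of_shortExact {T : ShortComplex (ModuleCat.{u} S)} (hT : T.ShortExact)
    (Y : ModuleCat.{u} S) (i : ℕ) (h₁ : Subsingleton (Ext T.X₁ Y i))
    (h₃ : Subsingleton (Ext T.X₃ Y i)) : Subsingleton (Ext T.X₂ Y i) := by
  refine subsingleton_of_forall_eq 0 fun x ↦ ?_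
  obtain ⟨y, rfl⟩ := Ext.contravariant_sequence_exact₂ hT Y x (Subsingleton.elim _ _)
  rw [Subsingleton.elim y 0, Ext.comp_zero]

lemma subsingleton_ext_X₃_of_shortExact {T : ShortComplex (ModuleCat.{u} S)} (hT : T.ShortExact)
    (Y : ModuleCat.{u} S) (i : ℕ) (h₁ : Subsingleton (Ext T.X₁ Y i))
    (h₂ : Subsingleton (Ext T.X₂ Y (i + 1))) : Subsingleton (Ext T.X₃ Y (i + 1)) := by
  refine subsingleton_of_forall_eq 0 fun x ↦ ?_
  obtain ⟨y, rfl⟩ := Ext.contravariant_sequence_exact₃ hT Y x (Subsingleton.elim _ _)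
    (add_comm 1 i)
  rw [Subsingleton.elim y 0, Ext.comp_zero]

lemma subsingleton_ext_of_linearEquiv {M N : Type u} [AddCommGroup M] [Module S M]
    [AddCommGroup N] [Module S N] (e : M ≃ₗ[S] N) (Y : ModuleCat.{u} S) (i : ℕ)
    (h : Subsingleton (Ext (ModuleCat.of S M) Y i)) :
    Subsingleton (Ext (ModuleCat.of S N) Y i) := by
  refine subsingleton_of_forall_eq 0 fun x ↦ ?_
  have hx : (Ext.mk₀ e.symm.toModuleIso.hom).comp ((Ext.mk₀ e.toModuleIso.hom).comp x
      (zero_add i)) (zero_add i) = x := by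
    rw [Ext.mk₀_comp_mk₀_assoc]
    have : e.symm.toModuleIso.hom ≫ e.toModuleIso.hom = 𝟙 _ := by ext; simp
    rw [this, Ext.mk₀_id_comp]
  rw [← hx, Subsingleton.elim ((Ext.mk₀ e.toModuleIso.hom).comp x (zero_add i)) 0, Ext.comp_zero]

/-- Nakayama's lemma for `Ext`: if `Ext^(i+1)(M/xM, Y) = 0` then `Ext^i(M, Y) = 0`. -/
lemma subsingleton_ext_of_quotSMulTop [IsLocalRing S] [IsNoetherianRing S]
    (M Y : ModuleCat.{u} S) [Module.Finite S M] [Module.Finite S Y] {x : S}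
    (hx : x ∈ maximalIdeal S) (hreg : IsSMulRegular M x) (i : ℕ)
    (h : Subsingleton (Ext (ModuleCat.of S (QuotSMulTop x M)) Y (i + 1))) :
    Subsingleton (Ext M Y i) := by
  by_contra! hntr
  have hann : x ∈ (Module.annihilator S (Ext M Y i)).jacobson :=
    IsLocalRing.maximalIdeal_le_jacobson _ hx
  refine Submodule.top_ne_pointwise_smul_of_mem_jacobson_annihilator hann ?_
  rw [eq_comm, eq_top_iff]
  intro y _
  -- The long exact sequence of $0\to M\xrightarrow{x}M\to M/xM\to0$ makes multiplication by `x`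
  -- surjective on $\operatorname{Ext}^i(M,Y)$.
  obtain ⟨z, hz⟩ : ∃ z : Ext M Y i, (Ext.mk₀ (x • 𝟙 M)).comp z (zero_add i) = y :=
    Ext.contravariant_sequence_exact₁ hreg.smulShortComplex_shortExact Y y
      (add_comm 1 i) (@Subsingleton.elim _ h _ _)
  rw [Ext.mk₀_smul, Ext.smul_comp, Ext.mk₀_id_comp] at hz
  exact hz ▸ Submodule.smul_mem_pointwise_smul _ _ ⊤ trivial

lemma subsingleton_ext_quotSMulTop (M Y : ModuleCat.{u} S) {x : S} (hreg : IsSMulRegular M x)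
    (i : ℕ) (h₁ : Subsingleton (Ext M Y i)) (h₂ : Subsingleton (Ext M Y (i + 1))) :
    Subsingleton (Ext (ModuleCat.of S (QuotSMulTop x M)) Y (i + 1)) :=
  subsingleton_ext_X₃_of_shortExact hreg.smulShortComplex_shortExact Y i h₁ h₂

/-- Vanishing of `Ext` on the quotients by prime ideals propagates to finitely generated modules. -/
lemma subsingleton_ext_of_forall_prime [IsNoetherianRing S] (Y : ModuleCat.{u} S) (i : ℕ)
    (M : Type u) [AddCommGroup M] [Module S M] [Module.Finite S M] (d : WithBot ℕ∞)
    (hM : Module.supportDim S M ≤ d)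
    (h : ∀ p : PrimeSpectrum S, ringKrullDim (S ⧸ p.asIdeal) ≤ d →
      Subsingleton (Ext (ModuleCat.of S (S ⧸ p.asIdeal)) Y i)) :
    Subsingleton (Ext (ModuleCat.of S M) Y i) := by
  induction ‹Module.Finite S M› using
    IsNoetherianRing.induction_on_isQuotientEquivQuotientPrime S with
  | subsingleton N =>
    refine subsingleton_of_forall_eq 0 fun x ↦ ?_
    have : 𝟙 (ModuleCat.of S N) = 0 := by ext; exact Subsingleton.elim _ _
    rw [← Ext.mk₀_id_comp x, this, Ext.mk₀_zero, Ext.zero_comp]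
  | quotient N p e =>
    refine subsingleton_ext_of_linearEquiv e.symm Y i (h p ?_)
    rwa [← Module.supportDim_quotient_eq_ringKrullDim, ← Module.supportDim_eq_of_equiv e]
  | exact N₁ N₂ N₃ f g hf hg hfg h₁ h₃ =>
    have hT : (ModuleCat.shortComplexOfCompEqZero f g hfg.linearMap_comp_eq_zero).ShortExact :=
      { exact := ModuleCat.shortComplex_exact _ hfg
        mono_f := (ModuleCat.mono_iff_injective _).mpr hf
        epi_g := (ModuleCat.epi_iff_surjective _).mpr hg }
    exact subsingleton_ext_X₂_of_shortExact hT Y i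
      (h₁ ((Module.supportDim_le_of_injective f hf).trans hM))
      (h₃ ((Module.supportDim_le_of_surjective g hg).trans hM))

/-- For a prime `p` different from the maximal ideal, there is `x` in the maximal ideal which is
regular on `S/p` and cuts its dimension down. -/
lemma exists_isSMulRegular_quotient_of_ne_maximalIdeal [IsLocalRing S] [IsNoetherianRing S]
    (p : Ideal S) [p.IsPrime] (hp : p ≠ maximalIdeal S) :
    ∃ x ∈ maximalIdeal S, IsSMulRegular (S ⧸ p) x ∧
      Module.supportDim S (QuotSMulTop x (S ⧸ p)) + 1 = ringKrullDim (S ⧸ p) := by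
  obtain ⟨x, hx, hxp⟩ := SetLike.exists_of_lt
    (lt_of_le_of_ne (le_maximalIdeal (Ideal.IsPrime.ne_top ‹_›)) hp)
  have hreg : IsSMulRegular (S ⧸ p) x := by
    rw [isSMulRegular_iff_right_eq_zero_of_smul]
    intro y hy
    obtain ⟨y, rfl⟩ := Ideal.Quotient.mk_surjective y
    rw [Algebra.smul_def, Ideal.Quotient.algebraMap_eq, ← map_mul,
      Ideal.Quotient.eq_zero_iff_mem] at hy
    exact Ideal.Quotient.eq_zero_iff_mem.mpr ((Ideal.IsPrime.mem_or_mem ‹_› hy).resolve_left hxp)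
  refine ⟨x, hx, hreg, ?_⟩
  rw [← Module.supportDim_quotient_eq_ringKrullDim]
  exact supportDim_quotSMulTop_succ_eq_supportDim hreg hx

/-- Vanishing of `Ext` of the residue field propagates to finitely generated modules: `A d i` says
that degree `i` is considered for modules of dimension at most `d`. -/
lemma subsingleton_ext_of_residueField [IsLocalRing S] [IsNoetherianRing S]
    (Y : ModuleCat.{u} S) [Module.Finite S Y] (A : ℕ → ℕ → Prop)
    (hA : ∀ d i, A (d + 1) i → A d i ∧ A d (i + 1))
    (hκ : ∀ i, A 0 i → Subsingleton (Ext (ModuleCat.of S (S ⧸ maximalIdeal S)) Y i))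
    (d : ℕ) (M : Type u) [AddCommGroup M] [Module S M] [Module.Finite S M]
    (hM : Module.supportDim S M ≤ d) (i : ℕ) (hi : A d i) :
    Subsingleton (Ext (ModuleCat.of S M) Y i) := by
  have hA0 : ∀ d i, A d i → A 0 i := fun d ↦ by
    induction d with
    | zero => exact fun _ h ↦ h
    | succ d ih => exact fun i h ↦ ih i (hA d i h).1
  induction d generalizing M i with
  | zero =>
    refine subsingleton_ext_of_forall_prime Y i M _ hM fun p hp ↦ ?_
    by_cases hpm : p.asIdeal = maximalIdeal S
    · exact hpm ▸ hκ i hi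
    · obtain ⟨x, hx, hreg, hdim⟩ := exists_isSMulRegular_quotient_of_ne_maximalIdeal p.asIdeal hpm
      have := nontrivial_quotSMulTop_of_mem_maximalIdeal (S ⧸ p.asIdeal) hx
      rw [← hdim, Nat.cast_zero, ENat.WithBot.add_one_le_zero_iff] at hp
      exact absurd hp (Module.supportDim_ne_bot_of_nontrivial _ _)
  | succ d ih =>
    refine subsingleton_ext_of_forall_prime Y i M _ hM fun p hp ↦ ?_
    by_cases hpm : p.asIdeal = maximalIdeal S
    · exact hpm ▸ hκ i (hA0 _ i hi)
    · obtain ⟨x, hx, hreg, hdim⟩ := exists_isSMulRegular_quotient_of_ne_maximalIdeal p.asIdeal hpm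
      rw [← hdim, Nat.cast_add, Nat.cast_one, ENat.WithBot.add_le_add_one_right_iff] at hp
      -- Lowering the dimension by one costs one degree: this is why `A` must pass from `(d + 1, i)`
      -- to `(d, i + 1)`.
      exact subsingleton_ext_of_quotSMulTop (ModuleCat.of S (S ⧸ p.asIdeal)) Y hx hreg i
        (ih _ hp _ (hA d i hi).2)

end ExtVanishing

/-! ### Ext into a regular local ring, and regular sequences. -/

namespace IsRegularLocalRing

open IsLocalRing RingTheory.Sequence Module

variable {S : Type u} [CommRing S] [IsRegularLocalRing S] {n : ℕ} (hn : ringKrullDim S = n)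
include hn

/-- The maximal ideal is generated by a regular sequence of length `n`. Below `n` this kills Ext
because $S$ has that much depth; above `n` because the residue field has projective dimension `n`.
-/
lemma subsingleton_ext_residueField (i : ℕ) (hi : i ≠ n) :
    Subsingleton (Ext (ModuleCat.of S (S ⧸ maximalIdeal S)) (ModuleCat.of S S) i) := by
  obtain ⟨rs, hlen, hreg, hspan⟩ := exists_isRegular_ofList_eq_maximalIdeal S n hn
  rcases hi.lt_or_gt with hi | hi
  · refine ModuleCat.subsingleton_ext_of_exists_isRegular (maximalIdeal S) _ ?_ _ ?_ rs
      (fun r hr ↦ hspan ▸ Ideal.subset_span hr) hreg i (hlen ▸ hi)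
    · change Module.support S (S ⧸ maximalIdeal S) ⊆ _
      rw [Module.support_eq_zeroLocus, Ideal.annihilator_quotient]
    · change maximalIdeal S • (⊤ : Submodule S S) < ⊤
      simpa using (Ideal.IsPrime.ne_top' (I := maximalIdeal S)).lt_top
  · have hpd := ModuleCat.projectiveDimension_quotient_eq_length.{u} rs hreg
    have hpd' : HasProjectiveDimensionLT (ModuleCat.of S (Shrink.{u} (S ⧸ Ideal.ofList rs)))
        (n + 1) := (projectiveDimension_le_iff _ _).mp (by rw [hpd, hlen])
    rw [hspan] at hpd'
    exact subsingleton_ext_of_linearEquiv (Shrink.linearEquiv S (S ⧸ maximalIdeal S)) _ i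
      (HasProjectiveDimensionLT.subsingleton _ (n + 1) i (by omega) _)

omit [IsRegularLocalRing S] in
lemma supportDim_le (M : Type u) [AddCommGroup M] [Module S M] :
    Module.supportDim S M ≤ n := hn ▸ Module.supportDim_le_ringKrullDim S M

/-- A regular local ring of dimension `n` has injective dimension at most `n`. -/
lemma subsingleton_ext_of_ringKrullDim_lt (M : Type u) [AddCommGroup M] [Module S M]
    [Module.Finite S M] (i : ℕ) (hi : n < i) :
    Subsingleton (Ext (ModuleCat.of S M) (ModuleCat.of S S) i) :=
  subsingleton_ext_of_residueField (ModuleCat.of S S) (fun _ i ↦ n < i)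
    (fun _ i h ↦ ⟨h, by omega⟩) (fun i h ↦ subsingleton_ext_residueField hn i h.ne')
    n M (supportDim_le hn M) i hi

/-- Over a regular local ring `S`, `Ext^i(M, S)` vanishes for `i < dim S - dim M`. -/
lemma subsingleton_ext_of_add_supportDim_lt (M : Type u) [AddCommGroup M] [Module S M]
    [Module.Finite S M] (d : ℕ) (hM : Module.supportDim S M ≤ d) (i : ℕ) (hi : i + d < n) :
    Subsingleton (Ext (ModuleCat.of S M) (ModuleCat.of S S) i) :=
  subsingleton_ext_of_residueField (ModuleCat.of S S) (fun d i ↦ i + d < n)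
    (fun _ i h ↦ ⟨by omega, by omega⟩) (fun i h ↦ subsingleton_ext_residueField hn i (by omega))
    d M hM i hi

/-- Otherwise every $\operatorname{Ext}^i(\kappa,S)$ vanishes, and propagation with the always-true
predicate gives $\operatorname{Hom}(S,S)=0$. -/
lemma nontrivial_ext_residueField :
    Nontrivial (Ext (ModuleCat.of S (S ⧸ maximalIdeal S)) (ModuleCat.of S S) n) := by
  by_contra! h
  have h0 := subsingleton_ext_of_residueField (ModuleCat.of S S) (fun _ _ ↦ True)
    (fun _ i h ↦ ⟨trivial, trivial⟩) (fun i _ ↦ by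
      by_cases hi : i = n
      · exact hi ▸ h
      · exact subsingleton_ext_residueField hn i hi) n S (supportDim_le hn S) 0 trivial
  have h1 : (𝟙 (ModuleCat.of S S)) = 0 := by
    have := @Subsingleton.elim _ h0 (Ext.mk₀ (𝟙 (ModuleCat.of S S))) 0
    rwa [Ext.mk₀_eq_zero_iff] at this
  have h2 := congrArg (fun f : ModuleCat.of S S ⟶ ModuleCat.of S S ↦ f.hom (1 : S)) h1
  exact one_ne_zero (α := S) h2

/-- If `M` has a regular sequence of length `t`, then `Ext^i(M, S) = 0` for `i > dim S - t`. -/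
lemma subsingleton_ext_of_isWeaklyRegular (rs : List S) (hrs : ∀ r ∈ rs, r ∈ maximalIdeal S)
    (M : Type u) [AddCommGroup M] [Module S M] [Module.Finite S M] (hreg : IsWeaklyRegular M rs)
    (i : ℕ) (hi : n < i + rs.length) :
    Subsingleton (Ext (ModuleCat.of S M) (ModuleCat.of S S) i) := by
  induction rs generalizing M i with
  | nil => exact subsingleton_ext_of_ringKrullDim_lt hn M i (by simpa using hi)
  | cons r rs ih =>
    rw [isWeaklyRegular_cons_iff] at hreg
    rw [List.length_cons] at hi
    exact subsingleton_ext_of_quotSMulTop (ModuleCat.of S M) _ (hrs r List.mem_cons_self) hreg.1 i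
      (ih (fun s hs ↦ hrs s (List.mem_cons_of_mem _ hs)) _ hreg.2 (i + 1) (by omega))

/-- If `Ext^i(M, S) = 0` for `i > dim S - t`, then `M` has a regular sequence of length `t`. -/
lemma exists_isRegular_of_subsingleton_ext (t : ℕ) (ht : t ≤ n) (M : Type u) [AddCommGroup M] [Module S M]
    [Module.Finite S M] [Nontrivial M]
    (h : ∀ i, n < i + t → Subsingleton (Ext (ModuleCat.of S M) (ModuleCat.of S S) i)) :
    ∃ rs : List S, rs.length = t ∧ (∀ r ∈ rs, r ∈ maximalIdeal S) ∧ IsRegular M rs := by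
  induction t generalizing M with
  | zero => exact ⟨[], rfl, by simp, .nil S M⟩
  | succ t ih =>
    obtain ⟨r, hr, hreg⟩ : ∃ r ∈ maximalIdeal S, IsSMulRegular M r := by
      -- If no element of $\mathfrak m$ is regular on `M`, then $\kappa$ embeds in `M`. As
      -- $\operatorname{Ext}^{n+1}$ of the cokernel vanishes, $\operatorname{Ext}^n(M,S)=0$ surjects
      -- onto $\operatorname{Ext}^n(\kappa,S)\neq0$, a contradiction.
      suffices hsub : Subsingleton ((S ⧸ maximalIdeal S) →ₗ[S] M) by
        obtain ⟨r, hr, hreg⟩ := IsSMulRegular.subsingleton_linearMap_iff.mp hsub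
        exact ⟨r, by rwa [Ideal.annihilator_quotient] at hr, hreg⟩
      by_contra! hntr
      obtain ⟨f, hf⟩ := exists_ne (0 : (S ⧸ maximalIdeal S) →ₗ[S] M)
      have hinj : Function.Injective f := by
        have : IsSimpleModule S (S ⧸ maximalIdeal S) :=
          isSimpleModule_iff_isCoatom.mpr (maximalIdeal.isMaximal S).out
        exact (LinearMap.injective_or_eq_zero f).resolve_right hf
      have hfg := LinearMap.exact_map_mkQ_range f
      have hT : (ModuleCat.shortComplexOfCompEqZero f (LinearMap.range f).mkQ
          hfg.linearMap_comp_eq_zero).ShortExact :=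
        { exact := ModuleCat.shortComplex_exact _ hfg
          mono_f := (ModuleCat.mono_iff_injective _).mpr hinj
          epi_g := (ModuleCat.epi_iff_surjective _).mpr (Submodule.mkQ_surjective _) }
      obtain ⟨y, hy⟩ := @exists_ne _ (nontrivial_ext_residueField hn) 0
      obtain ⟨z, hz⟩ := Ext.contravariant_sequence_exact₁ hT (ModuleCat.of S S) y (add_comm 1 n)
        (@Subsingleton.elim _ (subsingleton_ext_of_ringKrullDim_lt hn _ (n + 1) (by omega)) _ _)
      refine hy (hz.symm.trans ?_)
      have := h n (by omega)
      rw [@Subsingleton.elim _ this z 0, Ext.comp_zero]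
    have := nontrivial_quotSMulTop_of_mem_maximalIdeal M hr
    obtain ⟨rs, hlen, hmem, hrs⟩ := ih (by omega) (QuotSMulTop r M) fun i hi ↦ by
      -- Degree zero has no predecessor, but it cannot occur since `t + 1 ≤ n`.
      cases i with
      | zero => omega
      | succ i =>
        exact subsingleton_ext_quotSMulTop (ModuleCat.of S M) _ hreg i (h i (by omega))
          (h (i + 1) (by omega))
    exact ⟨r :: rs, by simp [hlen], by simpa using ⟨hr, hmem⟩, .cons hreg hrs⟩

end IsRegularLocalRing

/-! ### Scalars annihilating Ext. -/

section SMulVanishing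

open Module

variable {S : Type u} [CommRing S]

/-- A scalar that kills `Ext^i(M, S)` kills `Ext^i(M, F)` for finite free `F`. -/
lemma ext_smul_eq_zero_of_free {M : ModuleCat.{u} S} {i : ℕ} {s : S}
    (h : ∀ x : Ext M (ModuleCat.of S S) i, s • x = 0) (F : ModuleCat.{u} S) [Module.Free S F]
    [Module.Finite S F] (x : Ext M F i) : s • x = 0 := by
  let b := Module.Free.chooseBasis S F
  let c (j) : F ⟶ ModuleCat.of S S := ModuleCat.ofHom (b.coord j)
  let e (j) : ModuleCat.of S S ⟶ F := ModuleCat.ofHom (LinearMap.toSpanSingleton S F (b j))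
  have hid : 𝟙 F = ∑ j, c j ≫ e j := by
    ext y
    simp only [ModuleCat.hom_sum, LinearMap.sum_apply]
    exact (b.sum_repr y).symm
  rw [← Ext.comp_mk₀_id x, hid, Ext.mk₀_sum, Ext.comp_sum, Finset.smul_sum]
  refine Finset.sum_eq_zero fun j _ ↦ ?_
  rw [← Ext.mk₀_comp_mk₀, ← Ext.comp_assoc_of_second_deg_zero, ← Ext.smul_comp, h,
    Ext.zero_comp]

lemma subsingleton_ext_of_free {M : ModuleCat.{u} S} {i : ℕ}
    (h : Subsingleton (Ext M (ModuleCat.of S S) i)) (F : ModuleCat.{u} S) [Module.Free S F]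
    [Module.Finite S F] : Subsingleton (Ext M F i) :=
  subsingleton_of_forall_eq 0 fun x ↦ by
    rw [← one_smul S x]
    exact ext_smul_eq_zero_of_free (fun y ↦ Subsingleton.elim _ _) F x

/-- Dimension shifting for scalars killing `Ext`. -/
lemma ext_X₃_smul_eq_zero_of_shortExact {T : ShortComplex (ModuleCat.{u} S)} (hT : T.ShortExact)
    (M : ModuleCat.{u} S) {i : ℕ} {s : S} (h₂ : Subsingleton (Ext M T.X₂ i))
    (h₁ : ∀ x : Ext M T.X₁ (i + 1), s • x = 0) (x : Ext M T.X₃ i) : s • x = 0 := by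
  obtain ⟨y, hy⟩ := Ext.covariant_sequence_exact₃ M hT (s • x) rfl (by rw [Ext.smul_comp, h₁])
  rw [← hy, Subsingleton.elim y 0, Ext.zero_comp]

end SMulVanishing

/-! ### Syzygies and the top Ext of a resolution. -/

namespace CategoryTheory.ProjectiveResolution

variable {S : Type u} [CommRing S] {M : ModuleCat.{u} S} (P : ProjectiveResolution M)

/-- The syzygies of a projective resolution. -/
noncomputable def syzygy : ℕ → ModuleCat.{u} S
  | 0 => M
  | j + 1 => ModuleCat.of S (LinearMap.range (P.complex.d (j + 1) j).hom)

lemma exists_shortExact_syzygy (j : ℕ) :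
    ∃ (f : P.syzygy (j + 1) ⟶ P.complex.X j) (g : P.complex.X j ⟶ P.syzygy j) (w : f ≫ g = 0),
      (ShortComplex.mk f g w).ShortExact := by
  let f : P.syzygy (j + 1) ⟶ P.complex.X j :=
    ModuleCat.ofHom (LinearMap.range (P.complex.d (j + 1) j).hom).subtype
  have hf : Mono f := (ModuleCat.mono_iff_injective _).mpr (Submodule.injective_subtype _)
  suffices h : ∃ g : P.complex.X j ⟶ P.syzygy j, Function.Surjective g.hom ∧
      Function.Exact (P.complex.d (j + 1) j).hom g.hom by
    obtain ⟨g, hg, hex⟩ := h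
    have hfg : Function.Exact f.hom g.hom := fun x ↦ (hex x).trans
      ⟨fun h ↦ ⟨⟨x, h⟩, rfl⟩, fun ⟨y, hy⟩ ↦ hy ▸ y.2⟩
    exact ⟨f, g, by ext x; exact hfg.apply_apply_eq_zero x,
      { exact := (ShortComplex.ShortExact.moduleCat_exact_iff_function_exact _).mpr hfg
        mono_f := hf
        epi_g := (ModuleCat.epi_iff_surjective _).mpr hg }⟩
  cases j with
  | zero =>
    have hπ : Epi (P.π.f 0) := inferInstance
    refine ⟨P.π.f 0, (ModuleCat.epi_iff_surjective _).mp hπ, ?_⟩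
    exact (ShortComplex.ShortExact.moduleCat_exact_iff_function_exact _).mp P.exact₀
  | succ j =>
    refine ⟨ModuleCat.ofHom (P.complex.d (j + 1) j).hom.rangeRestrict,
      LinearMap.surjective_rangeRestrict _, ?_⟩
    have := (ShortComplex.ShortExact.moduleCat_exact_iff_function_exact _).mp (P.exact_succ j)
    exact fun x ↦ Subtype.ext_iff.trans (this x)

/-- If the resolution `F` of `M` consists of finite free modules, `F_{k+1} = 0` and
`Ext^j(M, S) = 0` for `j < k`, then any scalar killing `Ext^k(M, S)` kills `M`. -/
lemma smul_eq_zero_of_ext_smul_eq_zero (hfree : ∀ i, Module.Free S (P.complex.X i))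
    (hfin : ∀ i, Module.Finite S (P.complex.X i)) (k : ℕ)
    (hk : Subsingleton (P.complex.X (k + 1)))
    (hvan : ∀ j < k, Subsingleton (Ext M (ModuleCat.of S S) j)) (s : S)
    (hs : ∀ x : Ext M (ModuleCat.of S S) k, s • x = 0) (m : M) : s • m = 0 := by
  -- Descending induction: for $j<k$, $\operatorname{Ext}^j(M,F_j)=0$ embeds
  -- $\operatorname{Ext}^j(M,Z_j)$ in $\operatorname{Ext}^{j+1}(M,Z_{j+1})$, where $Z_j$ is the
  -- $j$-th syzygy. At $j=k$, $Z_{k+1}=0$, so $\operatorname{Ext}^k(M,F_k)$ surjects onto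
  -- $\operatorname{Ext}^k(M,Z_k)$. The case $j=0$ applies to the identity of $M=Z_0$.
  have key : ∀ j ≤ k, ∀ x : Ext M (P.syzygy j) j, s • x = 0 := fun j hj ↦ by
    induction hj using Nat.decreasingInduction with
    | of_succ j hj ih =>
      obtain ⟨f, g, w, hT⟩ := P.exists_shortExact_syzygy j
      exact ext_X₃_smul_eq_zero_of_shortExact hT M (subsingleton_ext_of_free (hvan j hj) _) ih
    | self =>
      intro x
      obtain ⟨f, g, w, hT⟩ := P.exists_shortExact_syzygy k
      have hZ : 𝟙 (P.syzygy (k + 1)) = 0 := by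
        ext y
        obtain ⟨y, z, rfl⟩ := y
        refine Subtype.ext ?_
        change (P.complex.d (k + 1) k).hom z = 0
        rw [Subsingleton.elim z 0, map_zero]
      have hzero (y : Ext M (P.syzygy (k + 1)) (k + 1)) : y = 0 := by
        rw [← Ext.comp_mk₀_id y, hZ, Ext.mk₀_zero, Ext.comp_zero]
      obtain ⟨y, rfl⟩ := Ext.covariant_sequence_exact₃ M hT x rfl (hzero _)
      rw [← Ext.smul_comp, ext_smul_eq_zero_of_free hs (P.complex.X k) y, Ext.zero_comp]
  have h0 : s • 𝟙 M = 0 := by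
    have : s • Ext.mk₀ (𝟙 M) = 0 := key 0 (Nat.zero_le k) (Ext.mk₀ (𝟙 M))
    rwa [← Ext.mk₀_smul, Ext.mk₀_eq_zero_iff] at this
  exact congrArg (fun f : M ⟶ M ↦ f.hom m) h0

lemma subsingleton_ext_of_subsingleton_X {i : ℕ} (hi : Subsingleton (P.complex.X i))
    (Y : ModuleCat.{u} S) : Subsingleton (Ext M Y i) := by
  refine subsingleton_of_forall_eq 0 fun x ↦ ?_
  obtain ⟨f, hf, rfl⟩ := P.extMk_surjective x (i + 1) rfl
  obtain rfl : f = 0 := by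
    ext y
    rw [Subsingleton.elim y 0, map_zero, map_zero]
  exact P.extMk_zero _ rfl

/-- In the top degree `k` of a resolution `F`, the group `Ext^k(M, Y)` is a quotient of
`Hom(F_k, Y)` by the maps that factor through the differential `F_k → F_{k-1}`. -/
lemma exists_surjective_hom_ext {k : ℕ} (hk : Subsingleton (P.complex.X (k + 1)))
    (Y : ModuleCat.{u} S) :
    ∃ Φ : (P.complex.X k →ₗ[S] Y) →ₗ[S] Ext M Y k, Function.Surjective Φ ∧
      ∀ f, Φ f = 0 → f = 0 ∨
        ∃ (p : ℕ) (g : P.complex.X p →ₗ[S] Y), f = g ∘ₗ (P.complex.d k p).hom := by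
  have hd : ∀ f : P.complex.X k ⟶ Y, P.complex.d (k + 1) k ≫ f = 0 := fun f ↦ by
    ext y
    rw [Subsingleton.elim y 0, map_zero, map_zero]
  cases k with
  | zero =>
    have hπ : Function.Bijective (P.π.f 0).hom := by
      refine ⟨?_, (ModuleCat.epi_iff_surjective _).mp inferInstance⟩
      have := (ShortComplex.ShortExact.moduleCat_exact_iff_function_exact _).mp P.exact₀
      refine (injective_iff_map_eq_zero _).mpr fun x hx ↦ ?_
      obtain ⟨y, rfl⟩ := (this x).mp hx
      rw [Subsingleton.elim y 0, map_zero]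
    let e : (P.complex.X 0) ≃ₗ[S] M := LinearEquiv.ofBijective (P.π.f 0).hom hπ
    let Φ : (P.complex.X 0 →ₗ[S] Y) ≃ₗ[S] Ext M Y 0 :=
      (e.congrLeft Y S).trans
        (ModuleCat.homLinearEquiv (S := S).symm.trans (Ext.linearEquiv₀ (R := S)).symm)
    exact ⟨Φ.toLinearMap, Φ.surjective, fun f hf ↦ Or.inl (Φ.map_eq_zero_iff.mp hf)⟩
  | succ p =>
    let Φ : (P.complex.X (p + 1) →ₗ[S] Y) →ₗ[S] Ext M Y (p + 1) :=
      { toFun f := P.extMk (ModuleCat.ofHom f) (p + 2) rfl (hd _)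
        map_add' f g := (P.add_extMk (ModuleCat.ofHom f) (ModuleCat.ofHom g) _ rfl _ _).symm
        map_smul' s f := by
          rw [RingHom.id_apply, Ext.smul_eq_comp_mk₀, P.extMk_comp_mk₀]
          congr 1 }
    refine ⟨Φ, fun x ↦ ?_, fun f hf ↦ Or.inr ?_⟩
    · obtain ⟨f, hf, rfl⟩ := P.extMk_surjective x (p + 2) rfl
      exact ⟨f.hom, rfl⟩
    · obtain ⟨g, hg⟩ := (P.extMk_eq_zero_iff (ModuleCat.ofHom f) (p + 2) rfl (hd _) p rfl).mp hf
      exact ⟨p, g.hom, congrArg ModuleCat.Hom.hom hg.symm⟩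

end CategoryTheory.ProjectiveResolution

/-! ### Consequences of minimality for the last Ext. -/

namespace IsMinimalFreeResolution

open IsLocalRing Module RingTheory.Sequence

/-- A linear form with values in `I` on a finite free module is in `I` times the dual. -/
lemma _root_.LinearMap.mem_smul_top_of_range_le {S F : Type*} [CommRing S] [AddCommGroup F]
    [Module S F] [Module.Free S F] [Module.Finite S F] (I : Ideal S) (f : F →ₗ[S] S)
    (hf : ∀ x, f x ∈ I) : f ∈ I • (⊤ : Submodule S (F →ₗ[S] S)) := by
  let b := Module.Free.chooseBasis S F
  have : f = ∑ j, f (b j) • b.coord j := by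
    refine b.ext fun i ↦ ?_
    simp
  rw [this]
  exact Submodule.sum_mem _ fun j _ ↦ Submodule.smul_mem_smul (hf _) trivial

section

variable {S : Type u} [CommRing S] [IsLocalRing S] {M : ModuleCat.{u} S}
  {P : ProjectiveResolution M} {k : ℕ} (hP : IsMinimalFreeResolution P k)
include hP

/-- A form that dies in $\operatorname{Ext}^k$ is zero or factors through a differential, so by
minimality its values lie in $\mathfrak m$. This lets Nakayama lift generators of
$\operatorname{Ext}^k$ to the dual of $F_k$. -/
lemma exists_surjective_dual_ext :
    ∃ Φ : (P.complex.X k →ₗ[S] S) →ₗ[S] Ext M (ModuleCat.of S S) k, Function.Surjective Φ ∧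
      LinearMap.ker Φ ≤ maximalIdeal S • (⊤ : Submodule S (P.complex.X k →ₗ[S] S)) := by
  have := hP.free k
  have := hP.finite k
  obtain ⟨Φ, hΦ, hker⟩ := P.exists_surjective_hom_ext
    (hP.subsingleton_of_lt (k + 1) (by omega)) (ModuleCat.of S S)
  refine ⟨Φ, hΦ, fun f hf ↦ ?_⟩
  rcases hker f hf with rfl | ⟨p, g, rfl⟩
  · exact zero_mem _
  · refine LinearMap.mem_smul_top_of_range_le _ _ fun x ↦ ?_
    have h1 : (P.complex.d k p).hom x ∈ maximalIdeal S • (⊤ : Submodule S (P.complex.X p)) :=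
      hP.minimal k p ⟨x, rfl⟩
    have h2 := Submodule.mem_map_of_mem (f := g) h1
    rw [Submodule.map_smul''] at h2
    exact (Submodule.smul_le.mpr fun r hr y _ ↦ Ideal.mul_mem_right _ _ hr) h2

/-- If `Ext^k(M, S)` is cyclic, so is the dual of `F_k`, and hence `F_k ≅ S`. -/
lemma nonempty_linearEquiv_of_ext_cyclic (v : Ext M (ModuleCat.of S S) k)
    (hv : ∀ y, ∃ s : S, y = s • v) : Nonempty (P.complex.X k ≃ₗ[S] S) := by
  have := hP.free k
  have := hP.finite k
  have := hP.nontrivial_last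
  obtain ⟨Φ, hΦ, hker⟩ := hP.exists_surjective_dual_ext
  obtain ⟨f₀, rfl⟩ := hΦ v
  have hspan : Submodule.span S {f₀} = ⊤ := by
    refine top_le_iff.mp (Submodule.le_of_le_smul_of_le_jacobson_bot
      (I := maximalIdeal S) Module.Finite.fg_top (maximalIdeal_le_jacobson _) fun f _ ↦ ?_)
    obtain ⟨s, hs⟩ := hv (Φ f)
    rw [← sub_add_cancel f (s • f₀), add_comm]
    refine Submodule.add_mem_sup (Submodule.smul_mem _ _ (Submodule.mem_span_singleton_self f₀))
      (hker ?_)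
    rw [LinearMap.mem_ker, map_sub, map_smul, hs, sub_self]
  have hle : finrank S (P.complex.X k →ₗ[S] S) ≤ 1 :=
    finrank_le_one f₀ fun f ↦ Submodule.mem_span_singleton.mp (hspan ▸ trivial)
  rw [finrank_linearMap_self] at hle
  have hpos : 0 < finrank S (P.complex.X k) :=
    (Module.finrank_pos_iff_of_free S _).mpr inferInstance
  exact ⟨LinearEquiv.ofFinrankEq _ _ (by rw [finrank_self]; omega)⟩

/-- Otherwise $F_k^*=\mathfrak m F_k^*$, so $F_k^*=0$ by Nakayama, although a nonzero free module
has nonzero coordinate forms. -/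
lemma nontrivial_ext : Nontrivial (Ext M (ModuleCat.of S S) k) := by
  have := hP.free k
  have := hP.finite k
  have := hP.nontrivial_last
  obtain ⟨Φ, hΦ, hker⟩ := hP.exists_surjective_dual_ext
  by_contra! h
  have htop : (⊤ : Submodule S (P.complex.X k →ₗ[S] S)) ≤ maximalIdeal S • ⊤ :=
    fun f _ ↦ hker (Subsingleton.elim _ _)
  have hbot := Submodule.eq_bot_of_le_smul_of_le_jacobson_bot _ _ Module.Finite.fg_top htop
    (maximalIdeal_le_jacobson _)
  have hsub : Subsingleton (P.complex.X k →ₗ[S] S) :=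
    (Submodule.subsingleton_iff S).mp (subsingleton_of_bot_eq_top hbot.symm)
  obtain ⟨x, hx⟩ := exists_ne (0 : P.complex.X k)
  obtain ⟨i, hi⟩ : ∃ i, (Module.Free.chooseBasis S (P.complex.X k)).repr x i ≠ 0 := by
    by_contra! h
    exact hx ((Module.Free.chooseBasis S (P.complex.X k)).repr.map_eq_zero_iff.mp
      (Finsupp.ext h))
  exact hi (LinearMap.congr_fun
    (Subsingleton.elim ((Module.Free.chooseBasis S (P.complex.X k)).coord i) 0) x)

end

end IsMinimalFreeResolution

/-! ### Depth as an attained bound. -/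

section LocalDepth

open IsLocalRing RingTheory.Sequence

lemma exists_isRegular_of_le_localDepth {R : Type u} [CommRing R] [IsLocalRing R] {d : ℕ}
    (h : (d : ℕ∞) ≤ localDepth R) :
    ∃ rs : List R, IsRegular R rs ∧ (∀ r ∈ rs, r ∈ maximalIdeal R) ∧ d ≤ rs.length := by
  by_contra! hlt
  cases d with
  | zero => exact absurd (hlt [] (.nil R R) (by simp)) (by simp)
  | succ d =>
    have : localDepth R ≤ (d : ℕ∞) := iSup_le fun rs ↦ by
      exact_mod_cast Nat.lt_succ_iff.mp (hlt rs.1 rs.2.1 rs.2.2)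
    have := h.trans this
    norm_cast at this
    omega

end LocalDepth

/-! ### The Auslander–Buchsbaum formula and the bound on the resolution length. -/

namespace IsMinimalFreeResolution

open IsLocalRing Module RingTheory.Sequence

variable {S : Type u} [CommRing S] [IsRegularLocalRing S] {n : ℕ} {I : Ideal S}
  {P : ProjectiveResolution (ModuleCat.of S (S ⧸ I))} {k : ℕ}

/-- One half of the Auslander–Buchsbaum formula: `k + depth (S/I) ≤ dim S`. -/
lemma add_length_le (hP : IsMinimalFreeResolution P k) (hn : ringKrullDim S = n)
    [IsLocalRing (S ⧸ I)] (rs : List (S ⧸ I)) (hreg : IsRegular (S ⧸ I) rs)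
    (hmem : ∀ r ∈ rs, r ∈ maximalIdeal (S ⧸ I)) : k + rs.length ≤ n := by
  obtain ⟨rs, rfl⟩ : ∃ rs' : List S, rs'.map (algebraMap S (S ⧸ I)) = rs :=
    (List.map_surjective_iff.mpr Ideal.Quotient.mk_surjective) rs
  by_contra! hlt
  rw [List.length_map] at hlt
  have hnt := hP.nontrivial_ext
  refine not_subsingleton _ (IsRegularLocalRing.subsingleton_ext_of_isWeaklyRegular hn rs
    (fun r hr ↦ ?_) (S ⧸ I) ((isWeaklyRegular_map_algebraMap_iff (S ⧸ I) _ rs).mp hreg.1) k hlt)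
  exact fun hu ↦ hmem _ (List.mem_map_of_mem hr) (hu.map (algebraMap S (S ⧸ I)))

/-- The other half of the Auslander–Buchsbaum formula: `S/I` has a regular sequence of
length `dim S - k`. -/
lemma exists_isRegular (hP : IsMinimalFreeResolution P k) (hn : ringKrullDim S = n)
    [IsLocalRing (S ⧸ I)] (t : ℕ) (ht : k + t = n) :
    ∃ rs : List (S ⧸ I), rs.length = t ∧ IsRegular (S ⧸ I) rs ∧
      ∀ r ∈ rs, r ∈ maximalIdeal (S ⧸ I) := by
  obtain ⟨rs, hlen, hmem, hreg⟩ := IsRegularLocalRing.exists_isRegular_of_subsingleton_ext hn t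
    (by omega) (S ⧸ I) fun i hi ↦
      P.subsingleton_ext_of_subsingleton_X (hP.subsingleton_of_lt i (by omega)) _
  have hmem' : ∀ r ∈ rs.map (algebraMap S (S ⧸ I)), r ∈ maximalIdeal (S ⧸ I) := by
    intro r hr
    obtain ⟨s, hs, rfl⟩ := List.mem_map.mp hr
    have := IsLocalHom.of_surjective (algebraMap S (S ⧸ I)) Ideal.Quotient.mk_surjective
    exact fun hu ↦ hmem s hs (isUnit_of_map_unit (algebraMap S (S ⧸ I)) s hu)
  refine ⟨rs.map (algebraMap S (S ⧸ I)), by simpa using hlen, ?_, hmem'⟩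
  exact .of_isWeaklyRegular_of_mem_maximalIdeal _ hmem'
    ((isWeaklyRegular_map_algebraMap_iff (S ⧸ I) _ rs).mpr hreg.1)

/-- The Auslander–Buchsbaum formula, for a quotient of a regular local ring. -/
lemma localDepth_eq (hP : IsMinimalFreeResolution P k) (hn : ringKrullDim S = n)
    [IsLocalRing (S ⧸ I)] (t : ℕ) (ht : k + t = n) : localDepth (S ⧸ I) = t := by
  refine le_antisymm (iSup_le fun rs ↦ ?_) ?_
  · have := hP.add_length_le hn rs.1 rs.2.1 rs.2.2
    exact_mod_cast (by omega : rs.1.length ≤ t)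
  · obtain ⟨rs, hlen, hreg, hmem⟩ := hP.exists_isRegular hn t ht
    exact le_iSup_of_le ⟨rs, hreg, hmem⟩ (by rw [hlen])

/-- $\operatorname{Ext}^k(R,S)$ is nonzero, whereas Ext vanishes in degrees below $n-d$. -/
lemma le_add_of_ringKrullDim_eq (hP : IsMinimalFreeResolution P k) (hn : ringKrullDim S = n)
    {d : ℕ} (hd : ringKrullDim (S ⧸ I) = d) : n ≤ k + d := by
  by_contra! hlt
  have hnt := hP.nontrivial_ext
  exact not_subsingleton _ (IsRegularLocalRing.subsingleton_ext_of_add_supportDim_lt hn (S ⧸ I) d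
    (by rw [Module.supportDim_quotient_eq_ringKrullDim, hd]) k hlt)

end IsMinimalFreeResolution

/-! ### The Gorenstein criterion. -/

/-- Reconciles the two module structures, so that generators and annihilators over $R$ can be
computed over $S$. -/
lemma ExtOver.algebraMap_smul_eq {S R : Type u} [CommRing S] [CommRing R] [Algebra S R] (c : ℕ)
    (s : S) (x : Ext (ModuleCat.of S R) (ModuleCat.of S S) c) :
    (algebraMap S R s • (show ExtOver S R c from x) : ExtOver S R c) = s • x := by
  have h : mulEnd S R (algebraMap S R s) = s • 𝟙 (ModuleCat.of S R) := by
    ext y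
    exact (Algebra.smul_def s (y : R)).symm
  change (Ext.mk₀ (mulEnd S R (algebraMap S R s))).comp x (zero_add c) = s • x
  rw [h, Ext.mk₀_smul, Ext.smul_comp, Ext.mk₀_id_comp]

theorem proposition3p2 {S : Type u} [CommRing S] [IsRegularLocalRing S] (I : Ideal S) (n d : ℕ)
    (hn : ringKrullDim S = n) (hd : ringKrullDim (S ⧸ I) = d)
    (P : ProjectiveResolution (ModuleCat.of S (S ⧸ I))) (k : ℕ)
    (hP : IsMinimalFreeResolution P k) :
    IsGorensteinOver S (S ⧸ I) ↔ (k = n - d ∧ Nonempty (P.complex.X k ≃ₗ[S] S)) := by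
  have hntr : Nontrivial (S ⧸ I) := by
    by_contra! h
    rw [ringKrullDim_eq_bot_of_subsingleton] at hd
    exact WithBot.bot_ne_natCast _ hd
  have hloc : IsLocalRing (S ⧸ I) :=
    IsLocalRing.of_surjective' (Ideal.Quotient.mk I) Ideal.Quotient.mk_surjective
  have hdn : d ≤ n := by
    have := ringKrullDim_quotient_le I
    rw [hn, hd] at this
    exact_mod_cast this
  have hnk := hP.le_add_of_ringKrullDim_eq hn hd
  constructor
  · rintro ⟨hCM, n', d', hn', hd', hfree, hrank⟩
    obtain rfl : n = n' := by rw [hn] at hn'; exact_mod_cast hn'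
    obtain rfl : d = d' := by rw [hd] at hd'; exact_mod_cast hd'
    obtain ⟨rs, hreg, hmem, hlen⟩ := exists_isRegular_of_le_localDepth (R := S ⧸ I) (d := d) (by
      have := hCM.depth_eq_dim
      rw [hd] at this
      exact (WithBot.coe_injective this).ge)
    have hkd := hP.add_length_le hn rs hreg hmem
    obtain rfl : k = n - d := by omega
    refine ⟨rfl, ?_⟩
    -- `finrank` is zero by default on a free module that is not finite, so rank one already forces
    -- finiteness.
    have : Module.Finite (S ⧸ I) (ExtOver S (S ⧸ I) (n - d)) :=
      Module.finite_of_finrank_pos (by omega)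
    let e : ExtOver S (S ⧸ I) (n - d) ≃ₗ[S ⧸ I] (S ⧸ I) :=
      LinearEquiv.ofFinrankEq _ _ (by rw [hrank, Module.finrank_self])
    refine hP.nonempty_linearEquiv_of_ext_cyclic (e.symm 1) fun y ↦ ?_
    obtain ⟨s, hs⟩ := Ideal.Quotient.mk_surjective (e y)
    have hy : algebraMap S (S ⧸ I) s • e.symm 1 = y := e.injective (by
      rw [map_smul, e.apply_symm_apply, smul_eq_mul, mul_one]
      exact hs)
    exact ⟨s, hy.symm.trans (ExtOver.algebraMap_smul_eq (n - d) s (e.symm 1))⟩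
  · rintro ⟨hk, ⟨e⟩⟩
    have hkd : k + d = n := by omega
    have hdepth := hP.localDepth_eq hn d hkd
    refine ⟨{ depth_eq_dim := by rw [hdepth, hd]; rfl }, n, d, hn, hd, ?_⟩
    rw [← hk]
    obtain ⟨Φ, hΦ, -⟩ := hP.exists_surjective_dual_ext
    -- The isomorphism `e` generates the dual of $F_k$, since $f=f(e^{-1}(1))\,e$ for every form
    -- $f$; its class therefore generates Ext.
    let v : ExtOver S (S ⧸ I) k := Φ e.toLinearMap
    have hv (y : Ext (ModuleCat.of S (S ⧸ I)) (ModuleCat.of S S) k) :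
        ∃ s : S, y = s • Φ e.toLinearMap := by
      obtain ⟨f, rfl⟩ := hΦ y
      refine ⟨f (e.symm 1), ?_⟩
      rw [← map_smul]
      congr 1
      ext x
      have : x = e x • e.symm 1 := e.injective (by simp)
      conv_lhs => rw [this, map_smul]
      simp [mul_comm]
    let φ : (S ⧸ I) ≃ₗ[S ⧸ I] ExtOver S (S ⧸ I) k :=
      LinearEquiv.ofBijective (LinearMap.toSpanSingleton (S ⧸ I) _ v) ⟨?_, ?_⟩
    · exact ⟨.of_equiv φ, by rw [← φ.finrank_eq, Module.finrank_self]⟩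
    · refine (injective_iff_map_eq_zero _).mpr fun r hr ↦ ?_
      obtain ⟨s, rfl⟩ := Ideal.Quotient.mk_surjective r
      have hs : s • Φ e.toLinearMap = 0 := (ExtOver.algebraMap_smul_eq k s _).symm.trans hr
      -- A scalar killing the generator kills all of $\operatorname{Ext}^k$, hence kills $1\in R$;
      -- the lower Ext vanish because $k=n-d$.
      have := P.smul_eq_zero_of_ext_smul_eq_zero hP.free hP.finite k
        (hP.subsingleton_of_lt (k + 1) (by omega))
        (fun j hj ↦ IsRegularLocalRing.subsingleton_ext_of_add_supportDim_lt hn (S ⧸ I) d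
          (by rw [Module.supportDim_quotient_eq_ringKrullDim, hd]) j (by omega)) s
        (fun y ↦ by
          obtain ⟨t, rfl⟩ := hv y
          rw [smul_comm, hs, smul_zero]) (1 : S ⧸ I)
      exact (Algebra.algebraMap_eq_smul_one s).trans this
    · intro y
      obtain ⟨s, hs⟩ := hv y
      exact ⟨algebraMap S (S ⧸ I) s, (ExtOver.algebraMap_smul_eq k s _).trans hs.symm⟩
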